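/- **Theorem.** There are absolute constants $C, C' > 0$ such that the following holds. Let $n \ge 1$, $N = 2^n$, $s \ge 1$, $m$ be integers and $0<\delta<1/3$. Norms of arrays are entrywise: $\|Z\|_1=\sum_i |Z_i|$, $\|Z\|_2=(\sum_i |Z_i|^2)^{1/2}$; an array is $r$-sparse if it has at most $r$ nonzero entries ($r$ real). For an image $X\in\mathbb{C}^{N\times N}$ let $\nabla X\in\mathbb{C}^{N\times N\times 2}$ be the discrete gradient, with entries $(X_{j+1,k}-X_{j,k},\; X_{j,k+1}-X_{j,k})$ at pixel $(j,k)$, where a component that would involve a pixel outside the image is $0$; let $\|X\|_{TV}=\|\nabla X\|_1$, and let $(\nabla X)_s$ be a best $s$-sparse approximation of $\nabla X$ (its $s$ largest-magnitude entries are kept, the others replaced by $0$). Let $\mathcal{H}$ be the discrete bivariate Haar transform, that is, the unitary map sending $X$ to its coefficients in the orthonormal basis of $\mathbb{C}^{N\times N}$ that consists of the images $h_{a,b}=N^{-1}H(a/N,b/N)$, $0\le a,b<N$, where $H$ runs over the constant function $1$ on $[0,1)^2$ and the functions $H_{j,k}^e(u,v)=2^jH^{e_1}(2^ju-k_1)H^{e_2}(2^jv-k_2)$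 with $0\le j\le n-1$, $k\in\{0,\dots,2^j-1\}^2$, $e\in\{(0,1),(1,0),(1,1)\}$; here $H^0=\mathbf 1_{[0,1)}$ and $H^1=\mathbf 1_{[0,1/2)}-\mathbf 1_{[1/2,1)}$. Let $\mathcal{A}:\mathbb{C}^{N\times N}\to\mathbb{C}^m$ be linear and suppose that $\mathcal{A}\mathcal{H}^{-1}$ has the restricted isometry property of order $C s\log^3(N)$ and level $\delta$, i.e. $(1-\delta)\|c\|_2^2\le\|\mathcal{A}\mathcal{H}^{-1}c\|_2^2\le(1+\delta)\|c\|_2^2$ for every $Cs\log^3(N)$-sparse coefficient array $c$. Then for every image $X\in\mathbb{C}^{N\times N}$ and all measurements $y=\mathcal{A}(X)+\xi$ with $\|\xi\|_2\le\varepsilon$, the program $$\min_Z \|Z\|_{TV}\quad\text{subject to}\quad \|\mathcal{A}(Z)-y\|_2\le\varepsilon$$ has a solution, and every solution $\hat X$ satisfies $$\|X-\hat X\|_2\;\le\; C'\left(\frac{\|\nabla X-(\nabla X)_s\|_1}{\sqrt{s}}+\varepsilon\right).$$ -/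

import Mathlib

noncomputable section

namespace TVRecovery

/-- The entrywise `ℓ¹` norm of a finitely indexed complex array. -/
def l1Norm {ι : Type*} [Fintype ι] (x : ι → ℂ) : ℝ := ∑ i, ‖x i‖

/-- `x` is `r`-sparse: it has at most `r` nonzero entries (`r` may be any real number). -/
def IsSparse {ι : Type*} (r : ℝ) (x : ι → ℂ) : Prop := ((Function.support x).ncard : ℝ) ≤ r

/-- `G` is a best `s`-sparse approximation of `Y` (in the `ℓ¹` norm; these are exactly the arrays
that keep `s` largest-magnitude entries of `Y`, or all of them if there are fewer than `s`, and
replace the others by zero). -/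
def IsBestSparseApprox {ι : Type*} [Fintype ι] (s : ℕ) (Y G : ι → ℂ) : Prop :=
  IsSparse (s : ℝ) G ∧ ∀ G' : ι → ℂ, IsSparse (s : ℝ) G' → l1Norm (Y - G) ≤ l1Norm (Y - G')

/-- Restricted isometry property of order `r` and level `δ` of a linear map. -/
def HasRIP {ι : Type*} [Fintype ι] {m : ℕ}
    (T : EuclideanSpace ℂ ι →ₗ[ℂ] EuclideanSpace ℂ (Fin m)) (r δ : ℝ) : Prop :=
  ∀ x : EuclideanSpace ℂ ι, IsSparse r (fun i => x i) →
    (1 - δ) * ‖x‖ ^ 2 ≤ ‖T x‖ ^ 2 ∧ ‖T x‖ ^ 2 ≤ (1 + δ) * ‖x‖ ^ 2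

/-- Complex `2 ^ n × 2 ^ n` images, with the Frobenius norm. Pixels are indexed from `0`. -/
abbrev Image (n : ℕ) : Type := EuclideanSpace ℂ (Fin (2 ^ n) × Fin (2 ^ n))

/-- The discrete gradient: at pixel `(j, k)`, component `0` is `X (j+1, k) - X (j, k)` and component
`1` is `X (j, k+1) - X (j, k)`, replaced by `0` where the neighbour is outside the image. -/
def grad {n : ℕ} (X : Image n) : (Fin (2 ^ n) × Fin (2 ^ n)) × Fin 2 → ℂ := fun p =>
  if p.2 = 0 then
    if h : (p.1.1 : ℕ) + 1 < 2 ^ n then X (⟨p.1.1 + 1, h⟩, p.1.2) - X (p.1.1, p.1.2) else 0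
  else
    if h : (p.1.2 : ℕ) + 1 < 2 ^ n then X (p.1.1, ⟨p.1.2 + 1, h⟩) - X (p.1.1, p.1.2) else 0

/-- The (anisotropic) total variation seminorm. -/
def tvNorm {n : ℕ} (X : Image n) : ℝ := l1Norm (grad X)

/-- `Xhat` is a solution of the total variation minimization program:
minimize `‖Z‖_TV` subject to `‖A Z - y‖₂ ≤ ε`. -/
def IsTVMinimizer {n m : ℕ} (A : Image n →ₗ[ℂ] EuclideanSpace ℂ (Fin m))
    (y : EuclideanSpace ℂ (Fin m)) (ε : ℝ) (Xhat : Image n) : Prop :=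
  ‖A Xhat - y‖ ≤ ε ∧ ∀ Z : Image n, ‖A Z - y‖ ≤ ε → tvNorm Xhat ≤ tvNorm Z

/-- The univariate functions `H⁰` (indicator of `[0,1)`) and `H¹` (Haar mother wavelet). -/
def haarMother (e : Fin 2) (t : ℝ) : ℝ :=
  if 0 ≤ t ∧ t < 1 then (if e = 0 ∨ t < 1 / 2 then 1 else -1) else 0

/-- The bivariate Haar function `H_{j,k}^e (u, v) = 2 ^ j H^e (2 ^ j (u, v) - k)`, where
`H^e (u, v) = H^{e₁} (u) H^{e₂} (v)`. -/
def haarFun (j : ℕ) (k : ℕ × ℕ) (e : Fin 2 × Fin 2) (u v : ℝ) : ℝ :=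
  2 ^ j * (haarMother e.1 (2 ^ j * u - k.1) * haarMother e.2 (2 ^ j * v - k.2))

/-- Indices of the discrete Haar basis: `none` is the constant function and `⟨j, k, e⟩` is the
wavelet of scale `j ≤ n - 1`, position `k ∈ {0, …, 2 ^ j - 1}²` and type
`e ∈ {(0,1), (1,0), (1,1)}`. -/
abbrev HaarIndex (n : ℕ) : Type :=
  Option ((j : Fin n) × ((Fin (2 ^ (j : ℕ)) × Fin (2 ^ (j : ℕ))) × {e : Fin 2 × Fin 2 // e ≠ 0}))

/-- The function on `[0,1)²` that belongs to a Haar index. -/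
def haarIndexFun {n : ℕ} : HaarIndex n → ℝ → ℝ → ℝ
  | none => haarFun 0 (0, 0) (0, 0)
  | some ⟨j, k, e⟩ => haarFun j (k.1, k.2) e.1

/-- The discrete Haar basis images. A function `f` on `[0,1)²` that is constant on the
pixels `[a/N, (a+1)/N) × [b/N, (b+1)/N)`, `N = 2 ^ n`, is identified with the image `X` for which
`f = N X_{a,b}` on that pixel. -/
def haarImage {n : ℕ} (i : HaarIndex n) : Image n :=
  WithLp.toLp 2 fun p =>
    (((2 : ℝ) ^ n)⁻¹ * haarIndexFun i ((p.1 : ℝ) / 2 ^ n) ((p.2 : ℝ) / 2 ^ n) : ℝ)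

/-! ### Orthonormality of the Haar images -/

/-- `haarMother e (q / 2 - k)` for natural numbers `q`, `k`. -/
def haarStep (e : Fin 2) (k q : ℕ) : ℝ :=
  if q / 2 = k then (if e = 0 ∨ q % 2 = 0 then 1 else -1) else 0

theorem haarMother_eq (e : Fin 2) (n j k a : ℕ) (hj : j < n) :
    haarMother e (2 ^ j * ((a : ℝ) / 2 ^ n) - k) = haarStep e k (a / 2 ^ (n - j - 1)) := by
  obtain ⟨d, rfl⟩ : ∃ d, n = j + d + 1 := ⟨n - j - 1, by omega⟩
  have hd : j + d + 1 - j - 1 = d := by omega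
  rw [hd]
  have hL : (0 : ℝ) < 2 ^ d := by positivity
  have hLn : 0 < 2 ^ d := by positivity
  have ht : (2 : ℝ) ^ j * ((a : ℝ) / 2 ^ (j + d + 1)) - k = a / (2 * 2 ^ d) - k := by
    rw [pow_add, pow_add]; field_simp
  rw [ht]
  set q := a / 2 ^ d with hq
  set r := a % 2 ^ d with hr
  have ha : a = 2 ^ d * q + r := (Nat.div_add_mod a (2 ^ d)).symm
  have hrl : r < 2 ^ d := Nat.mod_lt _ hLn
  set x : ℝ := (r : ℝ) / 2 ^ d with hx
  have hx0 : 0 ≤ x := by positivity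
  have hx1 : x < 1 := by
    rw [hx, div_lt_one hL]; exact_mod_cast hrl
  have hval : (a : ℝ) / (2 * 2 ^ d) - k = ((q : ℝ) + x) / 2 - k := by
    rw [ha, hx]; push_cast; field_simp
  rw [hval]
  have h1 : (0 ≤ ((q : ℝ) + x) / 2 - k ∧ ((q : ℝ) + x) / 2 - k < 1) ↔ q / 2 = k := by
    constructor
    · rintro ⟨h, h'⟩
      have e1 : 2 * k < q + 1 := by
        have : (2 * k : ℝ) < q + 1 := by linarith
        exact_mod_cast this
      have e2 : q < 2 * k + 2 := by
        have : (q : ℝ) < 2 * k + 2 := by linarith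
        exact_mod_cast this
      omega
    · intro h
      have e1 : 2 * k ≤ q := by omega
      have e2 : q ≤ 2 * k + 1 := by omega
      have e1' : (2 * k : ℝ) ≤ q := by exact_mod_cast e1
      have e2' : (q : ℝ) ≤ 2 * k + 1 := by exact_mod_cast e2
      constructor <;> linarith
  unfold haarMother haarStep
  by_cases hk : q / 2 = k
  · rw [if_pos (h1.2 hk), if_pos hk]
    have h2 : ((q : ℝ) + x) / 2 - k < 1 / 2 ↔ q % 2 = 0 := by
      constructor
      · intro h
        have e1 : q < 2 * k + 1 := by
          have : (q : ℝ) < 2 * k + 1 := by linarith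
          exact_mod_cast this
        omega
      · intro h
        have e1 : q ≤ 2 * k := by omega
        have e1' : (q : ℝ) ≤ 2 * k := by exact_mod_cast e1
        linarith
    simp only [h2]
  · rw [if_neg (fun h => hk (h1.1 h)), if_neg hk]

theorem sum_range_mul_div (F : ℕ → ℝ) (M L : ℕ) :
    ∑ a ∈ Finset.range (M * L), F (a / L) = L * ∑ q ∈ Finset.range M, F q := by
  rcases Nat.eq_zero_or_pos L with rfl | hL
  · simp
  induction M with
  | zero => simp
  | succ M ih =>
    rw [Nat.succ_mul, Finset.sum_range_add, ih, Finset.sum_range_succ, mul_add]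
    congr 1
    rw [Finset.sum_congr rfl (g := fun _ => F M)]
    · simp
    · intro x hx
      rw [Nat.add_comm, Nat.add_mul_div_right _ _ hL, Nat.div_eq_of_lt (Finset.mem_range.1 hx),
        zero_add]

theorem haarStep_even (e : Fin 2) (k r : ℕ) : haarStep e k (2 * r) = if r = k then 1 else 0 := by
  unfold haarStep
  have h1 : 2 * r / 2 = r := by omega
  have h2 : 2 * r % 2 = 0 := by omega
  simp [h1, h2]

theorem haarStep_odd (e : Fin 2) (k r : ℕ) :
    haarStep e k (2 * r + 1) = if r = k then (if e = 0 then 1 else -1) else 0 := by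
  unfold haarStep
  have h1 : (2 * r + 1) / 2 = r := by omega
  have h2 : (2 * r + 1) % 2 = 1 := by omega
  simp [h1, h2]

theorem sum_range_two_mul (F : ℕ → ℝ) (M : ℕ) :
    ∑ q ∈ Finset.range (2 * M), F q = ∑ r ∈ Finset.range M, (F (2 * r) + F (2 * r + 1)) := by
  induction M with
  | zero => simp
  | succ M ih =>
    rw [Finset.sum_range_succ, ← ih, show 2 * (M + 1) = 2 * M + 1 + 1 by ring,
      Finset.sum_range_succ, Finset.sum_range_succ, add_assoc]

/-- The univariate discrete function of scale `j`, position `k`, type `e` at pixel `a`. -/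
def haarLine (n : ℕ) (e : Fin 2) (j k : ℕ) (a : ℕ) : ℝ :=
  haarMother e (2 ^ j * ((a : ℝ) / 2 ^ n) - k)

theorem sum_haarLine_same (n j : ℕ) (hj : j < n) (e e' : Fin 2) (k k' : ℕ) (hk : k < 2 ^ j) :
    ∑ a : Fin (2 ^ n), haarLine n e j k a * haarLine n e' j k' a =
      if k = k' ∧ e = e' then (2 : ℝ) ^ (n - j) else 0 := by
  rw [Fin.sum_univ_eq_sum_range (fun a => haarLine n e j k a * haarLine n e' j k' a)]
  simp only [haarLine, haarMother_eq _ n j _ _ hj]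
  have hN : 2 ^ n = (2 * 2 ^ j) * 2 ^ (n - j - 1) := by
    rw [← pow_succ', ← pow_add]; congr 1; omega
  rw [hN, sum_range_mul_div (fun q => haarStep e k q * haarStep e' k' q), sum_range_two_mul]
  have hP : (2 : ℝ) ^ (n - j) = 2 ^ (n - j - 1) * 2 := by
    rw [← pow_succ]; congr 1; omega
  rw [Finset.sum_eq_single_of_mem k (Finset.mem_range.2 hk)]
  · simp only [haarStep_even, haarStep_odd, hP]
    push_cast
    by_cases h : k = k'
    · fin_cases e <;> fin_cases e' <;> simp [h] <;> norm_num
    · simp [h]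
  · intro b _ hb
    simp [haarStep_even, haarStep_odd, hb]

theorem sum_haarLine_lt (n i j : ℕ) (hij : i < j) (hj : j < n) (e : Fin 2) (k k' : ℕ) :
    ∑ a : Fin (2 ^ n), haarLine n e i k a * haarLine n 1 j k' a = 0 := by
  rw [Fin.sum_univ_eq_sum_range (fun a => haarLine n e i k a * haarLine n 1 j k' a)]
  simp only [haarLine, haarMother_eq _ n j _ _ hj, haarMother_eq _ n i _ _ (hij.trans hj)]
  have hdiv : ∀ a : ℕ, a / 2 ^ (n - i - 1) = (a / 2 ^ (n - j - 1)) / 2 / 2 ^ (j - i - 1) := by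
    intro a
    rw [Nat.div_div_eq_div_mul, Nat.div_div_eq_div_mul, ← pow_succ', ← pow_add]
    congr 2; omega
  simp only [hdiv]
  have hN : 2 ^ n = (2 * 2 ^ j) * 2 ^ (n - j - 1) := by
    rw [← pow_succ', ← pow_add]; congr 1; omega
  rw [hN, sum_range_mul_div
    (fun q => haarStep e k (q / 2 / 2 ^ (j - i - 1)) * haarStep 1 k' q), sum_range_two_mul]
  rw [Finset.sum_eq_zero, mul_zero]
  intro r _
  have h1 : 2 * r / 2 = r := by omega
  have h2 : (2 * r + 1) / 2 = r := by omega
  rw [haarStep_even, haarStep_odd, h1, h2]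
  by_cases h : r = k' <;> simp [h]

theorem sum_haarLine_const (n j : ℕ) (hj : j < n) (k' : ℕ) :
    ∑ a : Fin (2 ^ n), haarLine n 0 0 0 a * haarLine n 1 j k' a = 0 := by
  rcases Nat.eq_zero_or_pos j with rfl | h
  · rw [sum_haarLine_same n 0 hj _ _ _ _ (by norm_num)]; simp
  · exact sum_haarLine_lt n 0 j h hj _ _ _

theorem haarLine_const (n : ℕ) (a : Fin (2 ^ n)) : haarLine n 0 0 0 a = 1 := by
  have h : ((a : ℕ) : ℝ) < 2 ^ n := by exact_mod_cast a.2
  have h0 : (0 : ℝ) ≤ ((a : ℕ) : ℝ) / 2 ^ n := by positivity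
  have h1 : ((a : ℕ) : ℝ) / 2 ^ n < 1 := by rw [div_lt_one (by positivity)]; exact h
  simp [haarLine, haarMother, h0, h1]

theorem inner_haarFun (n : ℕ) (j j' : ℕ) (k k' : ℕ × ℕ) (e e' : Fin 2 × Fin 2) :
    ∑ p : Fin (2 ^ n) × Fin (2 ^ n),
      (((2 : ℝ) ^ n)⁻¹ * haarFun j k e ((p.1 : ℝ) / 2 ^ n) ((p.2 : ℝ) / 2 ^ n)) *
      (((2 : ℝ) ^ n)⁻¹ * haarFun j' k' e' ((p.1 : ℝ) / 2 ^ n) ((p.2 : ℝ) / 2 ^ n)) =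
    (((2 : ℝ) ^ n)⁻¹ * 2 ^ j) * (((2 : ℝ) ^ n)⁻¹ * 2 ^ j') *
      ((∑ a : Fin (2 ^ n), haarLine n e.1 j k.1 a * haarLine n e'.1 j' k'.1 a) *
       (∑ a : Fin (2 ^ n), haarLine n e.2 j k.2 a * haarLine n e'.2 j' k'.2 a)) := by
  rw [Finset.sum_mul_sum, ← Finset.sum_product', Finset.mul_sum]
  refine Finset.sum_congr (by simp) ?_
  intro p _
  simp only [haarFun, haarLine]
  ring

theorem inner_haarImage {n : ℕ} (i i' : HaarIndex n) :
    inner ℂ (haarImage i) (haarImage i') = ((∑ p : Fin (2 ^ n) × Fin (2 ^ n),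
      (((2 : ℝ) ^ n)⁻¹ * haarIndexFun i ((p.1 : ℝ) / 2 ^ n) ((p.2 : ℝ) / 2 ^ n)) *
      (((2 : ℝ) ^ n)⁻¹ * haarIndexFun i' ((p.1 : ℝ) / 2 ^ n) ((p.2 : ℝ) / 2 ^ n)) : ℝ) : ℂ) := by
  rw [PiLp.inner_apply, Complex.ofReal_sum]
  refine Finset.sum_congr rfl fun p _ => ?_
  simp only [haarImage, RCLike.inner_apply, Complex.conj_ofReal]
  rw [← Complex.ofReal_mul, mul_comm]

theorem fin_two_ne_zero (e : Fin 2 × Fin 2) (he : e ≠ 0) : e.1 = 1 ∨ e.2 = 1 := by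
  rcases e with ⟨a, b⟩
  fin_cases a <;> fin_cases b <;> simp_all

theorem inner_wavelet_lt (n : ℕ) (j j' : ℕ) (h : j < j') (hj' : j' < n) (k k' : ℕ × ℕ)
    (e e' : Fin 2 × Fin 2) (he' : e' ≠ 0) :
    (∑ a : Fin (2 ^ n), haarLine n e.1 j k.1 a * haarLine n e'.1 j' k'.1 a) *
       (∑ a : Fin (2 ^ n), haarLine n e.2 j k.2 a * haarLine n e'.2 j' k'.2 a) = 0 := by
  rcases fin_two_ne_zero e' he' with h1 | h1
  · rw [h1, sum_haarLine_lt n j j' h hj', zero_mul]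
  · rw [h1, sum_haarLine_lt n j j' h hj', mul_zero]

theorem inner_wavelet_const (n : ℕ) (j' : ℕ) (hj' : j' < n) (k' : ℕ × ℕ)
    (e' : Fin 2 × Fin 2) (he' : e' ≠ 0) :
    (∑ a : Fin (2 ^ n), haarLine n 0 0 0 a * haarLine n e'.1 j' k'.1 a) *
       (∑ a : Fin (2 ^ n), haarLine n 0 0 0 a * haarLine n e'.2 j' k'.2 a) = 0 := by
  rcases fin_two_ne_zero e' he' with h1 | h1
  · rw [h1, sum_haarLine_const n j' hj', zero_mul]
  · rw [h1, sum_haarLine_const n j' hj', mul_zero]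

theorem haarImage_orthonormal (n : ℕ) : Orthonormal ℂ (haarImage (n := n)) := by
  classical
  rw [orthonormal_iff_ite]
  intro i i'
  rw [inner_haarImage]
  rcases i with _ | ⟨j, k, e⟩ <;> rcases i' with _ | ⟨j', k', e'⟩
  · simp only [haarIndexFun, inner_haarFun, haarLine_const]
    simp
    field_simp
  · simp only [haarIndexFun, inner_haarFun]
    simp only [inner_wavelet_const n j' j'.2 (k'.1, k'.2) e'.1 e'.2]
    simp
  · simp only [haarIndexFun, inner_haarFun]
    have := inner_wavelet_const n j j.2 (k.1, k.2) e.1 e.2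
    simp only [mul_comm (haarLine n 0 0 0 _)] at this
    simp only [this]
    simp
  · simp only [haarIndexFun, inner_haarFun]
    rcases lt_trichotomy j j' with h | h | h
    · simp only [inner_wavelet_lt n j j' h j'.2 (k.1, k.2) (k'.1, k'.2) e.1 e'.1 e'.2]
      simp [h.ne]
    · subst h
      simp only [sum_haarLine_same n j j.2 _ _ _ _ (k.1.2), sum_haarLine_same n j j.2 _ _ _ _ (k.2.2)]
      rcases k with ⟨k1, k2⟩
      rcases k' with ⟨k1', k2'⟩
      rcases e with ⟨⟨e1, e2⟩, he⟩
      rcases e' with ⟨⟨e1', e2'⟩, he'⟩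
      by_cases hh : (k1 = k1' ∧ e1 = e1') ∧ (k2 = k2' ∧ e2 = e2')
      · obtain ⟨⟨rfl, rfl⟩, rfl, rfl⟩ := hh
        simp only [and_self, if_true]
        have hp : (2 : ℝ) ^ n = 2 ^ (n - (j : ℕ)) * 2 ^ (j : ℕ) := by
          rw [← pow_add]; congr 1; omega
        rw [hp, ← Complex.ofReal_one, Complex.ofReal_inj]
        field_simp
      · have hne : ¬ ((some ⟨j, (k1, k2), ⟨(e1, e2), he⟩⟩ : HaarIndex n) =
            some ⟨j, (k1', k2'), ⟨(e1', e2'), he'⟩⟩) := by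
          intro h
          simp at h
          tauto
        rw [if_neg hne]
        simp only [Fin.val_inj]
        by_cases h1 : k1 = k1' ∧ e1 = e1'
        · have h2 : ¬ (k2 = k2' ∧ e2 = e2') := fun h2 => hh ⟨h1, h2⟩
          simp [h2]
        · simp [h1]
    · have := inner_wavelet_lt n j' j h j.2 (k'.1, k'.2) (k.1, k.2) e'.1 e.1 e.2
      simp only [mul_comm (haarLine n _ j' _ _)] at this
      simp only [this]
      simp [h.ne']

theorem card_haarIndex (n : ℕ) :
    Fintype.card (HaarIndex n) = Module.finrank ℂ (Image n) := by
  have h3 : Fintype.card {e : Fin 2 × Fin 2 // e ≠ 0} = 3 := by decide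
  rw [finrank_euclideanSpace, Fintype.card_option, Fintype.card_sigma]
  simp only [Fintype.card_prod, Fintype.card_fin, h3]
  rw [Fin.sum_univ_eq_sum_range (fun j => 2 ^ j * 2 ^ j * 3)]
  induction n with
  | zero => simp
  | succ n ih => rw [Finset.sum_range_succ, pow_succ]; linarith

/-- The discrete bivariate Haar basis of the space of images. -/
def haarBasis (n : ℕ) : OrthonormalBasis (HaarIndex n) ℂ (Image n) :=
  OrthonormalBasis.mk (haarImage_orthonormal n)
    ((haarImage_orthonormal n).linearIndependent.span_eq_top_of_card_eq_finrank'
      (card_haarIndex n)).ge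

/-- The discrete bivariate Haar transform `X ↦ (⟨X, h_{j,k}^e⟩)_{j,k,e}`. -/
def haarTransform (n : ℕ) : Image n ≃ₗᵢ[ℂ] EuclideanSpace ℂ (HaarIndex n) := (haarBasis n).repr

theorem haarTransform_apply {n : ℕ} (X : Image n) (i : HaarIndex n) :
    haarTransform n X i = inner ℂ (haarImage i) X := by
  rw [haarTransform, OrthonormalBasis.repr_apply_apply]
  simp [haarBasis]

theorem haarTransform_symm_apply {n : ℕ} (c : EuclideanSpace ℂ (HaarIndex n)) :
    (haarTransform n).symm c = ∑ i, c i • haarImage i := by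
  rw [haarTransform, ← OrthonormalBasis.sum_repr_symm]
  simp [haarBasis]

/-- The composite operator `A ∘ H⁻¹` on Haar coefficients. -/
def compHaarInv {n m : ℕ} (A : Image n →ₗ[ℂ] EuclideanSpace ℂ (Fin m)) :
    EuclideanSpace ℂ (HaarIndex n) →ₗ[ℂ] EuclideanSpace ℂ (Fin m) :=
  A ∘ₗ (haarTransform n).symm.toLinearEquiv.toLinearMap

/-- Best sparse approximations exist. -/
theorem exists_isBestSparseApprox {ι : Type*} [Fintype ι] (s : ℕ) (Y : ι → ℂ) :
    ∃ G, IsBestSparseApprox s Y G := by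
  classical
  obtain ⟨S, hS, hmin⟩ := Finset.exists_min_image
    ((Finset.univ : Finset (Finset ι)).filter fun S => S.card ≤ s)
    (fun S => ∑ i, if i ∈ S then (0 : ℝ) else ‖Y i‖) ⟨∅, by simp⟩
  refine ⟨fun i => if i ∈ S then Y i else 0, ?_, ?_⟩
  · unfold IsSparse
    have h : (Function.support fun i => if i ∈ S then Y i else 0) ⊆ (S : Set ι) := by
      intro i hi
      by_contra hc
      simp_all
    have h2 := Set.ncard_le_ncard h S.finite_toSet
    rw [Set.ncard_coe_finset] at h2
    exact_mod_cast h2.trans (Finset.mem_filter.1 hS).2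
  · intro G' hG'
    have hc : (Function.support G').toFinset.card ≤ s := by
      unfold IsSparse at hG'
      rw [Set.ncard_eq_toFinset_card'] at hG'
      exact_mod_cast hG'
    have h1 := hmin _ (Finset.mem_filter.2 ⟨Finset.mem_univ _, hc⟩)
    calc l1Norm (Y - fun i => if i ∈ S then Y i else 0)
        = ∑ i, if i ∈ S then (0 : ℝ) else ‖Y i‖ := by
          refine Finset.sum_congr rfl fun i _ => ?_
          by_cases hi : i ∈ S <;> simp [hi]
      _ ≤ _ := h1
      _ ≤ l1Norm (Y - G') := by
          refine Finset.sum_le_sum fun i _ => ?_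
          by_cases hi : G' i = 0 <;> simp [hi]

end TVRecovery

end

/-! Write `D = X - Xhat` and let `σ` be the `ℓ¹` error of the sparse approximation of `∇X`. The
heart of the proof is a Sobolev-type inequality, `norm_le_of_hasRIP_compHaarInv`: `‖D‖ ≤ 2‖A D‖ +
‖D‖_TV / (12√s)`. It combines two facts.

Haar coefficients are summable with a loss linear in `n` (`sum_norm_haarTransform_le`). A wavelet
oscillates in at least one direction; summation by parts in that direction moves the difference onto
`D`, and the primitives of the Haar functions of one scale are tents with disjoint supports. So each
scale and type contributes at most `‖D‖_TV / 2`, and the `3n` pairs together at most `(3/2) n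
‖D‖_TV`. The mean of `D` is the one coefficient that total variation cannot see.

The restricted isometry property turns `ℓ¹` control into `ℓ²` control (`norm_le_of_hasRIP`): if all
coordinates but one have `ℓ¹` norm `W`, then `‖x‖ ≤ 2‖T x‖ + 9W/√t`. The exempt coordinate absorbs
the mean. With `t` a large multiple of `s n²` the factor `n` cancels; this order is dominated by `s
log³ N`.

Minimality of `Xhat` gives the cone constraint, and the gradient is bounded on `ℓ²`, so `‖D‖_TV ≤
6√s ‖D‖ + 2σ` (`tvNorm_le_of_tvNorm_le`). Inserted in the Sobolev inequality, this leaves `‖D‖ / 2`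
on the right, which is absorbed; `‖A D‖ ≤ 2ε` by feasibility. The same inequality bounds the
feasible images of bounded total variation, whence a minimizer exists. -/

noncomputable section

namespace TVRecovery

/-! ### Sparse vectors and shelling -/

section Sparse

variable {ι : Type*}

/-- The restriction of a vector to a set of coordinates. -/
def restrictTo (S : Finset ι) [DecidableEq ι] (x : EuclideanSpace ℂ ι) : EuclideanSpace ℂ ι :=
  WithLp.toLp 2 fun i => if i ∈ S then x i else 0

variable [DecidableEq ι]

theorem restrictTo_apply (S : Finset ι) (x : EuclideanSpace ℂ ι) (i : ι) :
    restrictTo S x i = if i ∈ S then x i else 0 := rfl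

theorem restrictTo_add_restrictTo_sdiff {S U : Finset ι} (h : S ⊆ U) (x : EuclideanSpace ℂ ι) :
    restrictTo S x + restrictTo (U \ S) x = restrictTo U x := by
  ext i
  simp only [PiLp.add_apply, restrictTo_apply, Finset.mem_sdiff]
  by_cases h1 : i ∈ S
  · simp [h1, h h1]
  · simp [h1]

theorem restrictTo_univ [Fintype ι] (x : EuclideanSpace ℂ ι) :
    restrictTo Finset.univ x = x := by
  ext i
  simp [restrictTo_apply]

theorem isSparse_restrictTo {S : Finset ι} {r : ℝ} (h : (S.card : ℝ) ≤ r)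
    (x : EuclideanSpace ℂ ι) : IsSparse r (fun i => restrictTo S x i) := by
  have h1 : (Function.support fun i => restrictTo S x i) ⊆ (S : Set ι) := by
    intro i hi
    by_contra hc
    simp_all [restrictTo_apply]
  have h2 := Set.ncard_le_ncard h1 S.finite_toSet
  rw [Set.ncard_coe_finset] at h2
  exact le_trans (by exact_mod_cast h2) h

theorem norm_sq_restrictTo [Fintype ι] (S : Finset ι) (x : EuclideanSpace ℂ ι) :
    ‖restrictTo S x‖ ^ 2 = ∑ i ∈ S, ‖x i‖ ^ 2 := by
  rw [EuclideanSpace.norm_sq_eq, ← Finset.sum_subset (Finset.subset_univ S)]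
  · exact Finset.sum_congr rfl fun i hi => by simp [restrictTo_apply, hi]
  · intro i _ hi
    simp [restrictTo_apply, hi]

theorem norm_restrictTo_le_sqrt_mul [Fintype ι] {S : Finset ι} {t : ℕ} (ht : S.card ≤ t)
    {x : EuclideanSpace ℂ ι} {M : ℝ} (hM : 0 ≤ M) (h : ∀ i ∈ S, ‖x i‖ ≤ M) :
    ‖restrictTo S x‖ ≤ √t * M := by
  refine le_of_sq_le_sq ?_ (by positivity)
  rw [norm_sq_restrictTo, mul_pow, Real.sq_sqrt (Nat.cast_nonneg t)]
  calc ∑ i ∈ S, ‖x i‖ ^ 2 ≤ ∑ _i ∈ S, M ^ 2 :=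
        Finset.sum_le_sum fun i hi => pow_le_pow_left₀ (norm_nonneg _) (h i hi) 2
    _ = S.card * M ^ 2 := by simp
    _ ≤ t * M ^ 2 := by gcongr

theorem norm_sq_restrictTo_le_mul [Fintype ι] {S : Finset ι} {x : EuclideanSpace ℂ ι} {M : ℝ}
    (h : ∀ i ∈ S, ‖x i‖ ≤ M) : ‖restrictTo S x‖ ^ 2 ≤ M * ∑ i ∈ S, ‖x i‖ := by
  rw [norm_sq_restrictTo, Finset.mul_sum]
  refine Finset.sum_le_sum fun i hi => ?_
  rw [sq]
  exact mul_le_mul_of_nonneg_right (h i hi) (norm_nonneg _)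

/-- A finite set has a subset of any smaller size on which a function takes its largest values. -/
theorem exists_subset_card_eq_forall_le (f : ι → ℝ) (t : ℕ) (U : Finset ι) (h : t ≤ U.card) :
    ∃ S ⊆ U, S.card = t ∧ ∀ i ∈ S, ∀ j ∈ U \ S, f j ≤ f i := by
  induction t generalizing U with
  | zero => exact ⟨∅, by simp, by simp, by simp⟩
  | succ t ih =>
    obtain ⟨i, hi, hmax⟩ := U.exists_max_image f (Finset.card_pos.1 (by omega))
    obtain ⟨S, hS, hc, hf⟩ := ih (U.erase i) (by rw [Finset.card_erase_of_mem hi]; omega)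
    have hiS : i ∉ S := fun hh => Finset.notMem_erase i U (hS hh)
    refine ⟨insert i S, ?_, by rw [Finset.card_insert_of_notMem hiS, hc], ?_⟩
    · exact Finset.insert_subset hi (hS.trans (Finset.erase_subset i U))
    · intro a ha b hb
      simp only [Finset.mem_sdiff, Finset.mem_insert, not_or] at hb
      rcases Finset.mem_insert.1 ha with rfl | ha
      · exact hmax b hb.1
      · exact hf a ha b (by simp [hb])

/-- A linear map that is bounded by `b` on `t`-sparse vectors is bounded on all vectors by a
combination of the sup norm and the `ℓ¹` norm. -/
theorem norm_map_restrictTo_le [Fintype ι] {m : ℕ}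
    (T : EuclideanSpace ℂ ι →ₗ[ℂ] EuclideanSpace ℂ (Fin m)) {t : ℕ} (ht : 1 ≤ t) {b : ℝ}
    (hb : 0 ≤ b) (hT : ∀ z : EuclideanSpace ℂ ι, IsSparse (t : ℝ) (fun i => z i) →
      ‖T z‖ ≤ b * ‖z‖) (x : EuclideanSpace ℂ ι) (U : Finset ι) (M : ℝ) (hM : 0 ≤ M)
    (hU : ∀ i ∈ U, ‖x i‖ ≤ M) :
    ‖T (restrictTo U x)‖ ≤ b * (√t * M + (∑ i ∈ U, ‖x i‖) / √t) := by
  have ht0 : (0 : ℝ) < t := by exact_mod_cast ht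
  have hsum : ∀ V : Finset ι, 0 ≤ ∑ i ∈ V, ‖x i‖ := fun V =>
    Finset.sum_nonneg fun i _ => norm_nonneg _
  -- Shelling: peel off the `t` largest coordinates. What remains is bounded by the mean of the
  -- removed block, and `√t` times this mean is the `ℓ¹` norm of the block over `√t`. These terms
  -- add up to the `ℓ¹` norm over `√t`; only the first block is charged to `M`, so `M` must vary in
  -- the induction.
  induction U using Finset.strongInduction generalizing M with
  | H U ih =>
    rcases le_or_gt U.card t with hc | hc
    · refine (hT _ (isSparse_restrictTo (by exact_mod_cast hc) x)).trans ?_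
      gcongr
      have := norm_restrictTo_le_sqrt_mul hc hM hU
      have := div_nonneg (hsum U) (Real.sqrt_nonneg t)
      linarith
    · obtain ⟨S, hSU, hS, hle⟩ := exists_subset_card_eq_forall_le (fun i => ‖x i‖) t U hc.le
      have hne : S.Nonempty := Finset.card_pos.1 (by omega)
      have hM' : ∀ j ∈ U \ S, ‖x j‖ ≤ (∑ i ∈ S, ‖x i‖) / t := by
        intro j hj
        rw [le_div_iff₀ ht0, mul_comm, ← hS, ← nsmul_eq_mul]
        exact Finset.card_nsmul_le_sum _ _ _ fun i hi => hle i hi j hj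
      have h1 := ih (U \ S) (Finset.sdiff_ssubset hSU hne) _ (div_nonneg (hsum S) ht0.le) hM'
      have h2 := hT _ (isSparse_restrictTo (S := S) (by exact_mod_cast hS.le) x)
      have h3 := norm_restrictTo_le_sqrt_mul hS.le hM fun i hi => hU i (hSU hi)
      have h4 : √t * ((∑ i ∈ S, ‖x i‖) / t) = (∑ i ∈ S, ‖x i‖) / √t := by
        have h5 : √(t : ℝ) * √t = t := Real.mul_self_sqrt ht0.le
        have h6 : √(t : ℝ) ≠ 0 := (Real.sqrt_pos.2 ht0).ne'
        field_simp
        rw [sq, h5, mul_comm]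
      rw [h4] at h1
      rw [← restrictTo_add_restrictTo_sdiff hSU, map_add, ← Finset.sum_sdiff hSU, add_div]
      have h7 := norm_add_le (T (restrictTo S x)) (T (restrictTo (U \ S) x))
      have h8 := mul_le_mul_of_nonneg_left h3 hb
      linarith

/-- Under the restricted isometry property of order `t + 1`, the norm of a vector is controlled by
the norm of its image and the `ℓ¹` norm of all of its coordinates but one. -/
theorem norm_le_of_hasRIP [Fintype ι] {m : ℕ}
    {T : EuclideanSpace ℂ ι →ₗ[ℂ] EuclideanSpace ℂ (Fin m)} {t : ℕ} (ht : 1 ≤ t) {r δ : ℝ}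
    (hr : (t : ℝ) + 1 ≤ r) (hδ : δ < 1 / 3) (hT : HasRIP T r δ)
    (x : EuclideanSpace ℂ ι) (o : ι) :
    ‖x‖ ≤ 2 * ‖T x‖ + 9 * ((∑ i ∈ Finset.univ.erase o, ‖x i‖) / √t) := by
  have ht0 : (0 : ℝ) < t := by exact_mod_cast ht
  set W := ∑ i ∈ Finset.univ.erase o, ‖x i‖ with hW
  have hW0 : 0 ≤ W := Finset.sum_nonneg fun i _ => norm_nonneg _
  -- Threshold at `W / t`: by Markov's inequality at most `t` coordinates other than `o` exceed it,
  -- so with `o` the head has at most `t + 1`.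
  set U := (Finset.univ.erase o).filter fun i => ‖x i‖ ≤ W / t with hUdef
  have hsub : ∑ i ∈ U, ‖x i‖ ≤ W :=
    Finset.sum_le_sum_of_subset_of_nonneg (Finset.filter_subset _ _) fun i _ _ => norm_nonneg _
  have hUM : ∀ i ∈ U, ‖x i‖ ≤ W / t := fun i hi => (Finset.mem_filter.1 hi).2
  have hsq : √(t : ℝ) * √t = t := Real.mul_self_sqrt ht0.le
  have hsp : 0 < √(t : ℝ) := Real.sqrt_pos.2 ht0
  have hMt : √t * (W / t) = W / √t := by
    field_simp
    rw [sq, hsq, mul_comm]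
  -- The crude bounds `1 + δ ≤ 4` here and `1 - δ ≥ 1 / 4` in `hhead` give the factor `2` both
  -- times.
  have htail : ‖T (restrictTo U x)‖ ≤ 2 * (W / √t + W / √t) := by
    have h1 : ∀ z : EuclideanSpace ℂ ι, IsSparse (t : ℝ) (fun i => z i) → ‖T z‖ ≤ 2 * ‖z‖ := by
      intro z hz
      have h2 := (hT z (le_trans hz (by linarith))).2
      refine le_of_sq_le_sq ?_ (by positivity)
      nlinarith [sq_nonneg ‖z‖]
    refine (norm_map_restrictTo_le T ht zero_le_two h1 x U (W / t) (by positivity) hUM).trans ?_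
    rw [hMt]
    gcongr
  have htail2 : ‖restrictTo U x‖ ≤ W / √t := by
    refine le_of_sq_le_sq ?_ (by positivity)
    refine (norm_sq_restrictTo_le_mul hUM).trans ?_
    rw [div_pow, sq √(t : ℝ), hsq]
    calc W / t * ∑ i ∈ U, ‖x i‖ ≤ W / t * W := by gcongr
      _ = W ^ 2 / t := by ring
  have hcard : ((Finset.univ \ U).card : ℝ) ≤ r := by
    refine le_trans ?_ hr
    set V := (Finset.univ.erase o).filter fun i => ¬ ‖x i‖ ≤ W / t with hV
    have h1 : Finset.univ \ U ⊆ insert o V := by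
      intro i hi
      simp only [hUdef, hV, Finset.mem_sdiff, Finset.mem_univ, true_and, Finset.mem_filter,
        Finset.mem_erase, Finset.mem_insert, and_true] at hi ⊢
      tauto
    have h2 : V.card ≤ t := by
      by_contra hc
      have h4 : ∑ i ∈ V, ‖x i‖ ≤ W :=
        Finset.sum_le_sum_of_subset_of_nonneg (Finset.filter_subset _ _) fun i _ _ => norm_nonneg _
      have h5 : (t : ℝ) < V.card := by exact_mod_cast not_le.1 hc
      have hVne : V.Nonempty := Finset.card_pos.1 (by omega)
      have h6 : V.card * (W / t) < ∑ i ∈ V, ‖x i‖ := by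
        rw [← nsmul_eq_mul, ← Finset.sum_const]
        exact Finset.sum_lt_sum_of_nonempty hVne fun i hi => not_le.1 (Finset.mem_filter.1 hi).2
      have h7 : t * (W / t) ≤ V.card * (W / t) := by gcongr
      have h8 : t * (W / t) = W := by field_simp
      linarith
    have h3 := (Finset.card_le_card h1).trans (Finset.card_insert_le o V)
    exact_mod_cast h3.trans (Nat.succ_le_succ h2)
  have hx : restrictTo U x + restrictTo (Finset.univ \ U) x = x := by
    rw [restrictTo_add_restrictTo_sdiff (Finset.subset_univ U), restrictTo_univ]
  have hhead : ‖restrictTo (Finset.univ \ U) x‖ ≤ 2 * ‖T (restrictTo (Finset.univ \ U) x)‖ := by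
    have h1 := (hT _ (isSparse_restrictTo hcard x)).1
    refine le_of_sq_le_sq ?_ (by positivity)
    nlinarith [sq_nonneg ‖restrictTo (Finset.univ \ U) x‖]
  have h1 : ‖T (restrictTo (Finset.univ \ U) x)‖ ≤ ‖T x‖ + ‖T (restrictTo U x)‖ := by
    have : T (restrictTo (Finset.univ \ U) x) = T x - T (restrictTo U x) := by
      rw [← map_sub]
      congr 1
      exact eq_sub_of_add_eq' hx
    rw [this]
    exact norm_sub_le _ _
  have h2 : ‖x‖ ≤ ‖restrictTo U x‖ + ‖restrictTo (Finset.univ \ U) x‖ := by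
    conv_lhs => rw [← hx]
    exact norm_add_le _ _
  -- The tail itself counts once and its image four times, doubled by `hhead`: `1 + 2 * 4 = 9`.
  linarith

end Sparse

end TVRecovery

end
noncomputable section

namespace TVRecovery

/-! ### Haar coefficients and total variation -/

/-- The primitive of the univariate Haar function with steps of length `h` at position `k` is
supported on its interval and bounded by `h`. -/
theorem abs_sum_haarStep_le (h k a : ℕ) (hh : 0 < h) :
    |∑ i ∈ Finset.range a, haarStep 1 k (i / h)| ≤ if a / (2 * h) = k then (h : ℝ) else 0 := by
  -- The primitive is a tent: it rises with slope `1` on block `2k` of length `h` and falls back to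
  -- `0` on block `2k + 1`.
  have key : ∀ a : ℕ, ∑ i ∈ Finset.range a, haarStep 1 k (i / h) =
      if a / h = 2 * k then ((a % h : ℕ) : ℝ)
      else if a / h = 2 * k + 1 then (h : ℝ) - ((a % h : ℕ) : ℝ) else 0 := by
    intro a
    induction a with
    | zero =>
      rcases Nat.eq_zero_or_pos k with rfl | hk
      · simp
      · simp [hk.ne']
    | succ a ih =>
      rw [Finset.sum_range_succ, ih]
      have e1 := Nat.div_add_mod a h
      have e2 := Nat.mod_lt a hh
      have hstep : haarStep 1 k (a / h) =
          if a / h = 2 * k then 1 else if a / h = 2 * k + 1 then -1 else 0 := by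
        unfold haarStep
        by_cases h1 : a / h = 2 * k
        · simp [h1]
        · by_cases h2 : a / h = 2 * k + 1
          · have : (2 * k + 1) / 2 = k := by omega
            simp [h2, this]
          · have : ¬ a / h / 2 = k := by omega
            simp [h1, h2, this]
      rw [hstep]
      rcases Nat.lt_or_ge (a % h + 1) h with h3 | h3
      · have d1 : (a + 1) / h = a / h := by
          rw [Nat.div_eq_of_lt_le]
          · rw [mul_comm]; omega
          · rw [Nat.succ_mul, mul_comm]; omega
        have d2 : (a + 1) % h = a % h + 1 := by
          rw [Nat.add_mod, Nat.mod_eq_of_lt (a := _ + _)]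
          · rcases Nat.lt_or_ge 1 h with h1 | h1
            · rw [Nat.mod_eq_of_lt h1]
            · omega
          · rcases Nat.lt_or_ge 1 h with h1 | h1
            · rw [Nat.mod_eq_of_lt h1]; exact h3
            · omega
        rw [d1, d2]
        push_cast
        split_ifs <;> ring
      · have d3 : a % h + 1 = h := by omega
        have d4 : a + 1 = h * (a / h + 1) := by rw [mul_add]; omega
        have d1 : (a + 1) / h = a / h + 1 := by rw [d4, Nat.mul_div_cancel_left _ hh]
        have d2 : (a + 1) % h = 0 := by rw [d4, Nat.mul_mod_right]
        have d5 : ((a % h : ℕ) : ℝ) = h - 1 := by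
          have : ((a % h : ℕ) : ℝ) + 1 = h := by exact_mod_cast d3
          linarith
        rw [d1, d2, d5]
        by_cases h1 : a / h = 2 * k
        · simp [h1]
        · by_cases h2 : a / h = 2 * k + 1
          · simp [h2]
          · by_cases h4 : a / h + 1 = 2 * k
            · simp [h1, h2, h4]
            · simp [h1, h2, h4]
  rw [key, mul_comm 2 h, ← Nat.div_div_eq_div_mul]
  have e2 : ((a % h : ℕ) : ℝ) ≤ h := by exact_mod_cast (Nat.mod_lt a hh).le
  have e3 : (0 : ℝ) ≤ ((a % h : ℕ) : ℝ) := Nat.cast_nonneg _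
  by_cases h1 : a / h = 2 * k
  · have : a / h / 2 = k := by omega
    rw [if_pos h1, if_pos this, abs_of_nonneg e3]
    exact e2
  · by_cases h2 : a / h = 2 * k + 1
    · have : a / h / 2 = k := by omega
      rw [if_neg h1, if_pos h2, if_pos this, abs_of_nonneg (by linarith)]
      linarith
    · have : ¬ a / h / 2 = k := by omega
      simp [h1, h2, this]

/-- Summation by parts. For `M = 0` the truncated `M - 1` is harmless, as both sums are empty. -/
theorem sum_range_mul_eq_sub (T g : ℕ → ℂ) (M : ℕ) :
    ∑ i ∈ Finset.range M, T i * g i =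
      (∑ i ∈ Finset.range M, T i) * g (M - 1) -
      ∑ i ∈ Finset.range (M - 1), (∑ l ∈ Finset.range (i + 1), T l) * (g (i + 1) - g i) := by
  induction M with
  | zero => simp
  | succ M ih =>
    rw [Finset.sum_range_succ, ih]
    rcases M with _ | M
    · simp
    · simp only [Nat.add_sub_cancel]
      rw [Finset.sum_range_succ (fun i => (∑ l ∈ Finset.range (i + 1), T l) * (g (i + 1) - g i)) M,
        Finset.sum_range_succ T (M + 1)]
      ring

/-- The univariate Haar coefficients of one scale are bounded by the variation. -/
theorem sum_norm_sum_haarStep_le (h K : ℕ) (hh : 0 < h) (g : ℕ → ℂ) :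
    ∑ k ∈ Finset.range K, ‖∑ i ∈ Finset.range (K * (2 * h)), (haarStep 1 k (i / h) : ℂ) * g i‖ ≤
      h * ∑ i ∈ Finset.range (K * (2 * h) - 1), ‖g (i + 1) - g i‖ := by
  -- The endpoint lies in interval `K`, beyond the support of every tent, so the boundary term of
  -- the summation by parts vanishes.
  have hend : ∀ k ∈ Finset.range K, ∑ i ∈ Finset.range (K * (2 * h)), haarStep 1 k (i / h) = 0 := by
    intro k hk
    have h1 := abs_sum_haarStep_le h k (K * (2 * h)) hh
    rw [Nat.mul_div_cancel _ (by omega), if_neg (Finset.mem_range.1 hk).ne'] at h1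
    exact abs_nonpos_iff.1 h1
  calc _ ≤ ∑ k ∈ Finset.range K, ∑ i ∈ Finset.range (K * (2 * h) - 1),
        (if (i + 1) / (2 * h) = k then (h : ℝ) else 0) * ‖g (i + 1) - g i‖ := by
        refine Finset.sum_le_sum fun k hk => ?_
        rw [sum_range_mul_eq_sub, ← Complex.ofReal_sum, hend k hk, Complex.ofReal_zero, zero_mul,
          zero_sub, norm_neg]
        refine (norm_sum_le _ _).trans (Finset.sum_le_sum fun i _ => ?_)
        rw [norm_mul, ← Complex.ofReal_sum, Complex.norm_real, Real.norm_eq_abs]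
        exact mul_le_mul_of_nonneg_right (abs_sum_haarStep_le h k (i + 1) hh) (norm_nonneg _)
    _ ≤ _ := by
        -- For fixed `i` at most one tent is nonzero at `i + 1`, so summing over `k` costs nothing.
        rw [Finset.sum_comm, Finset.mul_sum]
        refine Finset.sum_le_sum fun i _ => ?_
        rw [← Finset.sum_mul]
        refine mul_le_mul_of_nonneg_right ?_ (norm_nonneg _)
        rw [Finset.sum_ite_eq]
        split_ifs <;> simp

/-- The forward difference of a finite sequence, `0` at the last index. -/
def forwardDiff {N : ℕ} (g : Fin N → ℂ) (a : Fin N) : ℂ :=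
  if h : (a : ℕ) + 1 < N then g ⟨a + 1, h⟩ - g a else 0

theorem sum_norm_sum_haarLine_le (n j : ℕ) (hj : j < n) (g : Fin (2 ^ n) → ℂ) :
    ∑ k : Fin (2 ^ j), ‖∑ a : Fin (2 ^ n), (haarLine n 1 j k a : ℂ) * g a‖ ≤
      2 ^ (n - j - 1) * ∑ a, ‖forwardDiff g a‖ := by
  set g' : ℕ → ℂ := fun i => if h : i < 2 ^ n then g ⟨i, h⟩ else 0 with hg'
  have hN : 2 ^ n = 2 ^ j * (2 * 2 ^ (n - j - 1)) := by
    rw [← pow_succ', ← pow_add]; congr 1; omega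
  have h1 := sum_norm_sum_haarStep_le (2 ^ (n - j - 1)) (2 ^ j) (by positivity) g'
  rw [← hN] at h1
  push_cast at h1
  have h2 : ∑ k : Fin (2 ^ j), ‖∑ a : Fin (2 ^ n), (haarLine n 1 j k a : ℂ) * g a‖ =
      ∑ k ∈ Finset.range (2 ^ j),
        ‖∑ i ∈ Finset.range (2 ^ n), (haarStep 1 k (i / 2 ^ (n - j - 1)) : ℂ) * g' i‖ := by
    rw [← Fin.sum_univ_eq_sum_range]
    refine Finset.sum_congr rfl fun k _ => ?_
    rw [← Fin.sum_univ_eq_sum_range]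
    congr 1
    refine Finset.sum_congr rfl fun a _ => ?_
    rw [haarLine, haarMother_eq _ n j _ _ hj]
    simp [hg']
  rw [h2]
  refine h1.trans (mul_le_mul_of_nonneg_left ?_ (by positivity))
  have h3 : ∑ a, ‖forwardDiff g a‖ = ∑ i ∈ Finset.range (2 ^ n),
      if i + 1 < 2 ^ n then ‖g' (i + 1) - g' i‖ else 0 := by
    rw [← Fin.sum_univ_eq_sum_range (fun i => if i + 1 < 2 ^ n then ‖g' (i + 1) - g' i‖ else 0)]
    refine Finset.sum_congr rfl fun a _ => ?_
    unfold forwardDiff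
    by_cases h : (a : ℕ) + 1 < 2 ^ n <;> simp [h, hg']
  rw [h3, ← Finset.sum_filter]
  refine Finset.sum_le_sum_of_subset_of_nonneg ?_ fun _ _ _ => norm_nonneg _
  intro i hi
  rw [Finset.mem_range] at hi
  simp only [Finset.mem_filter, Finset.mem_range]
  omega

/-- Functions of one scale have disjoint supports and modulus at most `1`. No more is needed in the
direction where the wavelet may fail to oscillate. -/
theorem sum_abs_haarLine_le (n j : ℕ) (hj : j < n) (e : Fin 2) (a : ℕ) :
    ∑ k : Fin (2 ^ j), |haarLine n e j k a| ≤ 1 := by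
  calc _ ≤ ∑ k : Fin (2 ^ j), if a / 2 ^ (n - j - 1) / 2 = k then (1 : ℝ) else 0 := by
        refine Finset.sum_le_sum fun k _ => ?_
        rw [haarLine, haarMother_eq _ n j _ _ hj, haarStep]
        split_ifs <;> simp
    _ ≤ 1 := by
        rw [Fin.sum_univ_eq_sum_range (fun k => if a / 2 ^ (n - j - 1) / 2 = k then (1 : ℝ) else 0),
          Finset.sum_ite_eq]
        split_ifs <;> simp

/-- The bivariate sums of one scale and of a type that oscillates in the first direction. -/
theorem sum_norm_sum_sum_haarLine_le (n j : ℕ) (hj : j < n) (e : Fin 2)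
    (Y : Fin (2 ^ n) → Fin (2 ^ n) → ℂ) :
    ∑ k₁ : Fin (2 ^ j), ∑ k₂ : Fin (2 ^ j),
      ‖∑ a : Fin (2 ^ n), ∑ b : Fin (2 ^ n), (haarLine n 1 j k₁ a : ℂ) * (haarLine n e j k₂ b : ℂ) * Y a b‖ ≤
      2 ^ (n - j - 1) * ∑ a, ∑ b, ‖forwardDiff (fun a => Y a b) a‖ := by
  calc _ ≤ ∑ k₁ : Fin (2 ^ j), ∑ k₂ : Fin (2 ^ j), ∑ b : Fin (2 ^ n),
        |haarLine n e j k₂ b| * ‖∑ a : Fin (2 ^ n), (haarLine n 1 j k₁ a : ℂ) * Y a b‖ := by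
        refine Finset.sum_le_sum fun k₁ _ => Finset.sum_le_sum fun k₂ _ => ?_
        rw [Finset.sum_comm]
        refine (norm_sum_le _ _).trans (Finset.sum_le_sum fun b _ => ?_)
        rw [← Real.norm_eq_abs, ← Complex.norm_real, ← norm_mul, Finset.mul_sum]
        refine le_of_eq (congrArg _ (Finset.sum_congr rfl fun a _ => by ring))
    _ = ∑ b : Fin (2 ^ n), (∑ k₂ : Fin (2 ^ j), |haarLine n e j k₂ b|) *
        ∑ k₁ : Fin (2 ^ j), ‖∑ a : Fin (2 ^ n), (haarLine n 1 j k₁ a : ℂ) * Y a b‖ := by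
        simp_rw [Finset.sum_mul_sum]
        conv_lhs => rw [Finset.sum_comm]
        conv_rhs => rw [Finset.sum_comm]
        refine Finset.sum_congr rfl fun k₂ _ => ?_
        conv_lhs => rw [Finset.sum_comm]
    _ ≤ ∑ b : Fin (2 ^ n), 1 * (2 ^ (n - j - 1) * ∑ a, ‖forwardDiff (fun a => Y a b) a‖) := by
        refine Finset.sum_le_sum fun b _ => ?_
        exact mul_le_mul (sum_abs_haarLine_le n j hj e b)
          (sum_norm_sum_haarLine_le n j hj fun a => Y a b)
          (Finset.sum_nonneg fun _ _ => norm_nonneg _) zero_le_one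
    _ = _ := by
        simp_rw [one_mul]
        rw [← Finset.mul_sum, Finset.sum_comm]

theorem tvNorm_eq {n : ℕ} (X : Image n) :
    tvNorm X = ∑ a, ∑ b, ‖forwardDiff (fun a => X (a, b)) a‖ +
      ∑ a, ∑ b, ‖forwardDiff (fun b => X (a, b)) b‖ := by
  unfold tvNorm l1Norm
  rw [Fintype.sum_prod_type, Fintype.sum_prod_type, ← Finset.sum_add_distrib]
  refine Finset.sum_congr rfl fun a _ => ?_
  rw [← Finset.sum_add_distrib]
  refine Finset.sum_congr rfl fun b _ => ?_
  rw [Fin.sum_univ_two]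
  simp [grad, forwardDiff]

theorem haarTransform_some {n : ℕ} (X : Image n) (j : Fin n)
    (k : Fin (2 ^ (j : ℕ)) × Fin (2 ^ (j : ℕ))) (e : {e : Fin 2 × Fin 2 // e ≠ 0}) :
    haarTransform n X (some ⟨j, k, e⟩) = (((2 : ℝ) ^ n)⁻¹ * 2 ^ (j : ℕ) : ℝ) *
      ∑ a : Fin (2 ^ n), ∑ b : Fin (2 ^ n),
        (haarLine n e.1.1 j k.1 a : ℂ) * (haarLine n e.1.2 j k.2 b : ℂ) * X (a, b) := by
  rw [haarTransform_apply, PiLp.inner_apply, Finset.mul_sum, Fintype.sum_prod_type]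
  refine Finset.sum_congr rfl fun a _ => ?_
  rw [Finset.mul_sum]
  refine Finset.sum_congr rfl fun b _ => ?_
  simp only [haarImage, RCLike.inner_apply, Complex.conj_ofReal, haarIndexFun, haarFun, haarLine]
  push_cast
  ring

theorem sum_norm_haarTransform_scale_le {n : ℕ} (X : Image n) (j : Fin n)
    (e : {e : Fin 2 × Fin 2 // e ≠ 0}) :
    ∑ k, ‖haarTransform n X (some ⟨j, k, e⟩)‖ ≤ 1 / 2 * tvNorm X := by
  -- The normalization `2 ^ j / N` cancels the tent height `2 ^ (n - j - 1)` up to `1 / 2`, so the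
  -- bound is the same at all scales.
  have hp : ((2 : ℝ) ^ n)⁻¹ * 2 ^ (j : ℕ) * 2 ^ (n - (j : ℕ) - 1) = 1 / 2 := by
    have : (2 : ℝ) ^ n = 2 ^ (j : ℕ) * 2 ^ (n - (j : ℕ) - 1) * 2 := by
      rw [← pow_add, ← pow_succ]; congr 1; omega
    rw [this]
    field_simp
  have hP : (0 : ℝ) ≤ ((2 : ℝ) ^ n)⁻¹ * 2 ^ (j : ℕ) := by positivity
  simp_rw [haarTransform_some, norm_mul, Complex.norm_real, Real.norm_of_nonneg hP]
  rw [← Finset.mul_sum, ← hp, mul_assoc (((2 : ℝ) ^ n)⁻¹ * 2 ^ (j : ℕ))]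
  refine mul_le_mul_of_nonneg_left ?_ hP
  rw [Fintype.sum_prod_type, tvNorm_eq]
  obtain ⟨⟨e₁, e₂⟩, he⟩ := e
  rcases fin_two_ne_zero _ he with h | h
  · simp only at h
    subst h
    refine (sum_norm_sum_sum_haarLine_le n j j.2 e₂ fun a b => X (a, b)).trans ?_
    gcongr
    exact le_add_of_nonneg_right
      (Finset.sum_nonneg fun _ _ => Finset.sum_nonneg fun _ _ => norm_nonneg _)
  -- Oscillation in the second direction: apply the same estimate to the transposed image.
  · simp only at h
    subst h
    have h1 := sum_norm_sum_sum_haarLine_le n j j.2 e₁ fun a b => X (b, a)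
    rw [Finset.sum_comm]
    rw [Finset.sum_comm (f := fun a b => ‖forwardDiff (fun a => X (b, a)) a‖)] at h1
    refine le_trans (le_of_eq ?_) (h1.trans ?_)
    · refine Finset.sum_congr rfl fun k₂ _ => Finset.sum_congr rfl fun k₁ _ => ?_
      rw [Finset.sum_comm]
      exact congrArg _ (Finset.sum_congr rfl fun a _ => Finset.sum_congr rfl fun b _ => by ring)
    · gcongr
      exact le_add_of_nonneg_left
        (Finset.sum_nonneg fun _ _ => Finset.sum_nonneg fun _ _ => norm_nonneg _)

/-- The `ℓ¹` norm of the wavelet coefficients is bounded by the total variation, up to the number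
of scales. -/
theorem sum_norm_haarTransform_le {n : ℕ} (X : Image n) :
    ∑ i ∈ Finset.univ.erase none, ‖haarTransform n X i‖ ≤ 3 / 2 * n * tvNorm X := by
  have h0 : ∑ i ∈ Finset.univ.erase none, ‖haarTransform n X i‖ =
      ∑ j : Fin n, ∑ e : {e : Fin 2 × Fin 2 // e ≠ 0},
        ∑ k, ‖haarTransform n X (some ⟨j, k, e⟩)‖ := by
    have h1 := Finset.add_sum_erase Finset.univ (fun i => ‖haarTransform n X i‖)
      (Finset.mem_univ none)
    rw [Fintype.sum_option] at h1
    rw [add_left_cancel h1, Fintype.sum_sigma]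
    refine Finset.sum_congr rfl fun j _ => ?_
    rw [Fintype.sum_prod_type, Finset.sum_comm]
  have h3 : Fintype.card {e : Fin 2 × Fin 2 // e ≠ 0} = 3 := by decide
  rw [h0]
  calc _ ≤ ∑ _j : Fin n, ∑ _e : {e : Fin 2 × Fin 2 // e ≠ 0}, 1 / 2 * tvNorm X :=
        Finset.sum_le_sum fun j _ => Finset.sum_le_sum fun e _ =>
          sum_norm_haarTransform_scale_le X j e
    _ = _ := by
        simp only [Finset.sum_const, Finset.card_univ, Fintype.card_fin, h3, nsmul_eq_mul]
        push_cast
        ring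

end TVRecovery

end
noncomputable section

namespace TVRecovery

/-! ### Total variation and sparse gradients -/

theorem sum_norm_sq_forwardDiff_le {N : ℕ} (g : Fin N → ℂ) :
    ∑ a, ‖forwardDiff g a‖ ^ 2 ≤ 4 * ∑ a, ‖g a‖ ^ 2 := by
  -- With the extension by zero, `F N = 0`, so the shifted sum loses only the term `F 0 ≥ 0`.
  set F : ℕ → ℝ := fun i => if h : i < N then ‖g ⟨i, h⟩‖ ^ 2 else 0 with hF
  have hF0 : 0 ≤ F 0 := by
    simp only [hF]
    split_ifs <;> positivity
  have h1 : ∑ a, ‖g a‖ ^ 2 = ∑ i ∈ Finset.range N, F i := by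
    rw [← Fin.sum_univ_eq_sum_range]
    exact Finset.sum_congr rfl fun a _ => by simp [hF]
  have h2 : ∑ i ∈ Finset.range N, F (i + 1) ≤ ∑ i ∈ Finset.range N, F i := by
    have h3 := Finset.sum_range_succ' F N
    rw [Finset.sum_range_succ] at h3
    have h4 : F N = 0 := by simp [hF]
    linarith
  calc _ ≤ ∑ a : Fin N, (2 * F (a + 1) + 2 * F a) := by
        refine Finset.sum_le_sum fun a _ => ?_
        have ha : F a = ‖g a‖ ^ 2 := by simp [hF]
        rw [ha]
        unfold forwardDiff
        by_cases h : (a : ℕ) + 1 < N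
        · have hb : F (a + 1) = ‖g ⟨a + 1, h⟩‖ ^ 2 := by simp [hF, h]
          rw [hb, dif_pos h]
          have := norm_sub_le (g ⟨a + 1, h⟩) (g a)
          have h0 := norm_nonneg (g ⟨a + 1, h⟩ - g a)
          nlinarith [sq_nonneg (‖g ⟨a + 1, h⟩‖ - ‖g a‖)]
        · have hb : F (a + 1) = 0 := by simp [hF, h]
          rw [hb, dif_neg h, norm_zero]
          nlinarith [sq_nonneg ‖g a‖]
    _ = 2 * ∑ i ∈ Finset.range N, F (i + 1) + 2 * ∑ i ∈ Finset.range N, F i := by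
        rw [Finset.sum_add_distrib, ← Finset.mul_sum, ← Finset.mul_sum,
          Fin.sum_univ_eq_sum_range (fun i => F (i + 1)), Fin.sum_univ_eq_sum_range F]
    _ ≤ _ := by rw [h1]; linarith

theorem sum_norm_sq_grad_le {n : ℕ} (X : Image n) : ∑ p, ‖grad X p‖ ^ 2 ≤ 8 * ‖X‖ ^ 2 := by
  have h1 : ∑ p, ‖grad X p‖ ^ 2 = ∑ b, ∑ a, ‖forwardDiff (fun a => X (a, b)) a‖ ^ 2 +
      ∑ a, ∑ b, ‖forwardDiff (fun b => X (a, b)) b‖ ^ 2 := by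
    rw [Finset.sum_comm, Fintype.sum_prod_type, Fintype.sum_prod_type, ← Finset.sum_add_distrib]
    refine Finset.sum_congr rfl fun a _ => ?_
    rw [← Finset.sum_add_distrib]
    refine Finset.sum_congr rfl fun b _ => ?_
    rw [Fin.sum_univ_two]
    simp [grad, forwardDiff]
  have h2 : ‖X‖ ^ 2 = ∑ a, ∑ b, ‖X (a, b)‖ ^ 2 := by
    rw [EuclideanSpace.norm_sq_eq, Fintype.sum_prod_type]
  have h3 : ∑ b, ∑ a, ‖forwardDiff (fun a => X (a, b)) a‖ ^ 2 ≤ 4 * ‖X‖ ^ 2 := by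
    rw [h2, Finset.sum_comm (f := fun a b => ‖X (a, b)‖ ^ 2), Finset.mul_sum]
    exact Finset.sum_le_sum fun b _ => sum_norm_sq_forwardDiff_le fun a => X (a, b)
  have h4 : ∑ a, ∑ b, ‖forwardDiff (fun b => X (a, b)) b‖ ^ 2 ≤ 4 * ‖X‖ ^ 2 := by
    rw [h2, Finset.mul_sum]
    exact Finset.sum_le_sum fun a _ => sum_norm_sq_forwardDiff_le fun b => X (a, b)
  linarith

/-- The cone constraint: if subtracting `E` from `Y` does not increase the `ℓ¹` norm, then `E` is
concentrated on the support of any sparse approximation of `Y`. -/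
theorem l1Norm_le_of_l1Norm_sub_le {ι : Type*} [Fintype ι] {s : ℕ} {Y E G : ι → ℂ}
    (hG : IsSparse (s : ℝ) G) (h : l1Norm (Y - E) ≤ l1Norm Y) :
    l1Norm E ≤ 2 * (√s * √(∑ i, ‖E i‖ ^ 2)) + 2 * l1Norm (Y - G) := by
  classical
  set S := (Function.support G).toFinset with hSdef
  have hS : (S.card : ℝ) ≤ s := by
    unfold IsSparse at hG
    rwa [Set.ncard_eq_toFinset_card'] at hG
  have hcs : ∑ i ∈ S, ‖E i‖ ≤ √s * √(∑ i, ‖E i‖ ^ 2) := by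
    rw [← Real.sqrt_mul (Nat.cast_nonneg s)]
    refine Real.le_sqrt_of_sq_le (sq_sum_le_card_mul_sum_sq.trans ?_)
    gcongr
    exact Finset.subset_univ S
  -- Triangle inequality, on `S` for `Y = (Y - E) + E` and off `S`, where `G = 0`, for `E = Y - (Y -
  -- E)`. The last bracket sums to at most `0` by hypothesis.
  have hpt : ∀ i, ‖E i‖ ≤ (if i ∈ S then 2 * ‖E i‖ else 0) + 2 * ‖(Y - G) i‖ +
      (‖(Y - E) i‖ - ‖Y i‖) := by
    intro i
    have h1 : ‖Y i‖ ≤ ‖(Y - E) i‖ + ‖E i‖ := by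
      simpa using norm_add_le ((Y - E) i) (E i)
    by_cases hi : i ∈ S
    · rw [if_pos hi]
      have := norm_nonneg ((Y - G) i)
      linarith
    · have hGi : G i = 0 := by simpa [hSdef] using hi
      have h2 : ‖E i‖ ≤ ‖Y i‖ + ‖(Y - E) i‖ := by
        simpa using norm_sub_le (Y i) ((Y - E) i)
      rw [if_neg hi, Pi.sub_apply, hGi, sub_zero]
      linarith
  have hsum := Finset.sum_le_sum fun i (_ : i ∈ Finset.univ) => hpt i
  rw [Finset.sum_add_distrib, Finset.sum_add_distrib, Finset.sum_sub_distrib, ← Finset.mul_sum,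
    Finset.sum_ite_mem, Finset.univ_inter, ← Finset.mul_sum] at hsum
  unfold l1Norm at h ⊢
  linarith

theorem grad_sub {n : ℕ} (X Y : Image n) : grad (X - Y) = grad X - grad Y := by
  ext p
  simp only [grad, Pi.sub_apply, PiLp.sub_apply]
  split_ifs <;> ring

theorem l1Norm_nonneg {ι : Type*} [Fintype ι] (x : ι → ℂ) : 0 ≤ l1Norm x :=
  Finset.sum_nonneg fun _ _ => norm_nonneg _

theorem tvNorm_sub_le {n : ℕ} (X Y : Image n) : tvNorm (X - Y) ≤ tvNorm X + tvNorm Y := by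
  unfold tvNorm l1Norm
  rw [grad_sub, ← Finset.sum_add_distrib]
  exact Finset.sum_le_sum fun i _ => norm_sub_le _ _

theorem tvNorm_le_of_tvNorm_le {n s : ℕ} {X Z : Image n}
    {G : (Fin (2 ^ n) × Fin (2 ^ n)) × Fin 2 → ℂ} (hG : IsSparse (s : ℝ) G)
    (h : tvNorm Z ≤ tvNorm X) :
    tvNorm (X - Z) ≤ 6 * √s * ‖X - Z‖ + 2 * l1Norm (grad X - G) := by
  have h1 : l1Norm (grad X - grad (X - Z)) ≤ l1Norm (grad X) := by
    rw [← grad_sub, sub_sub_cancel]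
    exact h
  have h2 : √(∑ p, ‖grad (X - Z) p‖ ^ 2) ≤ 3 * ‖X - Z‖ := by
    refine Real.sqrt_le_iff.2 ⟨by positivity, (sum_norm_sq_grad_le _).trans ?_⟩
    nlinarith [sq_nonneg ‖X - Z‖]
  have h3 := mul_le_mul_of_nonneg_left h2 (Real.sqrt_nonneg s)
  have h4 := l1Norm_le_of_l1Norm_sub_le hG h1
  unfold tvNorm
  linarith

theorem continuous_tvNorm (n : ℕ) : Continuous (tvNorm (n := n)) := by
  unfold tvNorm l1Norm
  refine continuous_finsetSum _ fun p _ => Continuous.norm ?_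
  unfold grad
  split_ifs <;> fun_prop

/-! ### Stable recovery -/

/-- The strong Sobolev inequality: images with few measurements are controlled by their total
variation. -/
theorem norm_le_of_hasRIP_compHaarInv {n s m : ℕ} (hn : 1 ≤ n) (hs : 1 ≤ s) {δ : ℝ}
    (hδ : δ < 1 / 3) {A : Image n →ₗ[ℂ] EuclideanSpace ℂ (Fin m)}
    (hA : HasRIP (compHaarInv A) (112900 * s * Real.log ((2 : ℝ) ^ n) ^ 3) δ) (D : Image n) :
    ‖D‖ ≤ 2 * ‖A D‖ + tvNorm D / (12 * √s) := by
  classical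
  have hn' : (1 : ℝ) ≤ n := by exact_mod_cast hn
  have hs' : (1 : ℝ) ≤ s := by exact_mod_cast hs
  -- Here `28224 = 168 ^ 2`, `112900 = 4 * 28225`, and `4` compensates `log 2 ^ 3 ≥ 1 / 4`.
  have hr : ((28224 * s * n ^ 2 : ℕ) : ℝ) + 1 ≤ 112900 * s * Real.log ((2 : ℝ) ^ n) ^ 3 := by
    have hl : (1 : ℝ) / 4 ≤ Real.log 2 ^ 3 := by
      have h1 : (0.69 : ℝ) ≤ Real.log 2 := by linarith [Real.log_two_gt_d9]
      calc (1 : ℝ) / 4 ≤ 0.69 ^ 3 := by norm_num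
        _ ≤ _ := by gcongr
    have h2 : (1 : ℝ) ≤ s * n ^ 2 := one_le_mul_of_one_le_of_one_le hs' (one_le_pow₀ hn')
    have h3 : (s : ℝ) * n ^ 2 ≤ s * n ^ 3 := by
      exact mul_le_mul_of_nonneg_left (pow_le_pow_right₀ hn' (by norm_num)) (by positivity)
    rw [Real.log_pow, mul_pow]
    push_cast
    have h4 : (s : ℝ) * n ^ 3 * (1 / 4) ≤ s * n ^ 3 * Real.log 2 ^ 3 := by gcongr
    linarith
  have ht : 1 ≤ 28224 * s * n ^ 2 := Nat.succ_le_of_lt (by positivity)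
  have h1 := norm_le_of_hasRIP ht hr hδ hA (haarTransform n D) none
  have hAD : compHaarInv A (haarTransform n D) = A D := by simp [compHaarInv]
  have hsqrt : √((28224 * s * n ^ 2 : ℕ) : ℝ) = 168 * √s * n := by
    push_cast
    rw [Real.sqrt_mul (by positivity), Real.sqrt_mul (by positivity), Real.sqrt_sq (by positivity)]
    congr 2
    rw [show (28224 : ℝ) = 168 ^ 2 by norm_num, Real.sqrt_sq (by norm_num)]
  rw [hAD, LinearIsometryEquiv.norm_map, hsqrt] at h1
  refine h1.trans ?_
  have hsp : 0 < √(s : ℝ) := Real.sqrt_pos.2 (by linarith)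
  have hn0 : (0 : ℝ) < n := by linarith
  -- The choice of `168` gives `9 * (3 / 2) / 168 = 27 / 336`, just below `1 / 12`.
  have h2 : 9 * ((∑ i ∈ Finset.univ.erase none, ‖haarTransform n D i‖) / (168 * √s * n)) ≤
      tvNorm D / (12 * √s) := by
    have htv : 0 ≤ tvNorm D := l1Norm_nonneg _
    calc _ ≤ 9 * ((3 / 2 * n * tvNorm D) / (168 * √s * n)) := by
          gcongr
          convert sum_norm_haarTransform_le D
      _ = 27 / 336 * (tvNorm D / √s) := by field_simp; ring
      _ ≤ 1 / 12 * (tvNorm D / √s) :=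
          mul_le_mul_of_nonneg_right (by norm_num) (by positivity)
      _ = _ := by field_simp
  linarith

/-- Total variation alone is not coercive, since it vanishes on constants. The Sobolev inequality
bounds the feasible images with total variation at most that of `X`, so compactness applies. -/
theorem exists_isTVMinimizer {n s m : ℕ} (hn : 1 ≤ n) (hs : 1 ≤ s) {δ : ℝ} (hδ : δ < 1 / 3)
    {A : Image n →ₗ[ℂ] EuclideanSpace ℂ (Fin m)}
    (hA : HasRIP (compHaarInv A) (112900 * s * Real.log ((2 : ℝ) ^ n) ^ 3) δ)
    {X : Image n} {y : EuclideanSpace ℂ (Fin m)} {ε : ℝ} (hX : ‖A X - y‖ ≤ ε) :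
    ∃ Xhat : Image n, IsTVMinimizer A y ε Xhat := by
  have hAc : Continuous A := A.continuous_of_finiteDimensional
  set K : Set (Image n) := {Z | ‖A Z - y‖ ≤ ε ∧ tvNorm Z ≤ tvNorm X} with hK
  have hclosed : IsClosed K :=
    (isClosed_le (hAc.sub continuous_const).norm continuous_const).inter
      (isClosed_le (continuous_tvNorm n) continuous_const)
  have hbdd : K ⊆ Metric.closedBall X (2 * (ε + ε) + (tvNorm X + tvNorm X) / (12 * √s)) := by
    rintro Z ⟨hZ, hTV⟩
    rw [mem_closedBall_iff_norm]
    refine (norm_le_of_hasRIP_compHaarInv hn hs hδ hA (Z - X)).trans ?_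
    have h1 : ‖A (Z - X)‖ ≤ ε + ε := by
      have : A (Z - X) = (A Z - y) - (A X - y) := by rw [map_sub]; abel
      rw [this]
      exact (norm_sub_le _ _).trans (add_le_add hZ hX)
    have h2 : tvNorm (Z - X) ≤ tvNorm X + tvNorm X :=
      (tvNorm_sub_le Z X).trans (add_le_add_left hTV _)
    gcongr
  have hcomp : IsCompact K := (isCompact_closedBall _ _).of_isClosed_subset hclosed hbdd
  obtain ⟨Z, hZ, hmin⟩ := hcomp.exists_isMinOn ⟨X, hX, le_rfl⟩ (continuous_tvNorm n).continuousOn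
  refine ⟨Z, hZ.1, fun Z' hZ' => ?_⟩
  rcases le_total (tvNorm Z') (tvNorm X) with h | h
  · exact hmin ⟨hZ', h⟩
  · exact hZ.2.trans h

end TVRecovery

end

/-! ### Absorption argument and the final error bound -/

theorem theorem3 :
    ∃ C : ℝ, 0 < C ∧ ∃ C' : ℝ, 0 < C' ∧
      ∀ (n : ℕ), 1 ≤ n → ∀ (s : ℕ), 1 ≤ s → ∀ (m : ℕ) (δ : ℝ), 0 < δ → δ < 1 / 3 →
      ∀ (A : TVRecovery.Image n →ₗ[ℂ] EuclideanSpace ℂ (Fin m)),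
        TVRecovery.HasRIP (TVRecovery.compHaarInv A) (C * s * Real.log ((2 : ℝ) ^ n) ^ 3) δ →
      ∀ (X : TVRecovery.Image n) (ξ y : EuclideanSpace ℂ (Fin m)) (ε : ℝ),
        ‖ξ‖ ≤ ε → y = A X + ξ →
        (∃ Xhat : TVRecovery.Image n, TVRecovery.IsTVMinimizer A y ε Xhat) ∧
        ∀ Xhat : TVRecovery.Image n, TVRecovery.IsTVMinimizer A y ε Xhat →
        ∀ G, TVRecovery.IsBestSparseApprox s (TVRecovery.grad X) G →
          ‖X - Xhat‖ ≤
            C' * (TVRecovery.l1Norm (TVRecovery.grad X - G) / Real.sqrt s + ε) := by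
  -- The estimates below give `‖D‖ ≤ 4ε + ‖D‖ / 2 + σ / (6√s)` for `D = X - Z`, hence `‖D‖ ≤ 8ε + σ
  -- / (3√s)`; this is where `8` comes from.
  refine ⟨112900, by norm_num, 8, by norm_num, ?_⟩
  intro n hn s hs m δ _ hδ A hA X ξ y ε hξ hy
  have hX : ‖A X - y‖ ≤ ε := by
    rw [hy, sub_add_cancel_left, norm_neg]
    exact hξ
  refine ⟨TVRecovery.exists_isTVMinimizer hn hs hδ hA hX, fun Z hZ G hG => ?_⟩
  have hs' : (1 : ℝ) ≤ s := by exact_mod_cast hs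
  have hsp : 0 < √(s : ℝ) := Real.sqrt_pos.2 (by linarith)
  have h1 := TVRecovery.norm_le_of_hasRIP_compHaarInv hn hs hδ hA (X - Z)
  have h2 : ‖A (X - Z)‖ ≤ ε + ε := by
    have : A (X - Z) = (A X - y) - (A Z - y) := by rw [map_sub]; abel
    rw [this]
    exact (norm_sub_le _ _).trans (add_le_add hX hZ.1)
  have h3 := TVRecovery.tvNorm_le_of_tvNorm_le hG.1 (hZ.2 X hX)
  have hσ := TVRecovery.l1Norm_nonneg (TVRecovery.grad X - G)
  set σ := TVRecovery.l1Norm (TVRecovery.grad X - G)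
  have h4 : TVRecovery.tvNorm (X - Z) / (12 * √s) ≤ 1 / 2 * ‖X - Z‖ + 1 / 6 * (σ / √s) := by
    rw [div_le_iff₀ (by positivity)]
    refine h3.trans (le_of_eq ?_)
    field_simp
    ring
  have h5 : 0 ≤ σ / √s := by positivity
  linarith
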